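/- Let $\mathbb{K}$ be a field of characteristic zero, $n\ge 0$, and let $\mathbb{K}[[x]]=\mathbb{K}[[x^1,\dots,x^n]]$. A formal vector field on $\mathbb{K}^n$ is a $\mathbb{K}$-linear derivation $X$ of $\mathbb{K}[[x]]$; it can be written uniquely as $X=\sum_i X^i\,\partial/\partial x^i$ with $X^i=X(x^i)=\sum_\alpha c^i_\alpha x^\alpha$. A formal diffeomorphism $\varphi$ of $\mathbb{K}^n$ is a $\mathbb{K}$-algebra automorphism of $\mathbb{K}[[x]]$, and $\varphi^*X:=\varphi\circ X\circ\varphi^{-1}$. Let $w=(w_1,\dots,w_n)$ be a weighting, that is, a tuple of integers with $1\le w_1\le\dots\le w_n$; put $\langle w,\alpha\rangle=\sum_i w_i\alpha_i$ for $\alpha\in\mathbb{N}^n$, let $\mathcal{F}^j\subseteq\mathbb{K}[[x]]$ ($j\in\mathbb{Z}$) be the ideal generated by the monomials $x^\alpha$ with $\langle w,\alpha\rangle\ge j$, and let $\mathcal{E}_w=\sum_i w_i x^i\,\partial/\partial x^i$ be the weighted Euler vector field. The weighted linear approximation of $X$ is $$X_{[0]}=\sum_{i}\Big(\sum_{\langle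 w,\alpha\rangle=w_i}c^i_\alpha x^\alpha\Big)\frac{\partial}{\partial x^i}.$$ Suppose that $X$ is weighted Euler-like with respect to $w$: it is $w$-admissible, i.e. $X(\mathcal{F}^j)\subseteq\mathcal{F}^j$ for all $j$, and $X_{[0]}=\mathcal{E}_w$. Then there exists a formal diffeomorphism $\varphi$ of $\mathbb{K}^n$ such that $\varphi^*X=\mathcal{E}_w$. -/

import Mathlib

namespace FormalWeighted

/-- Formal functions on `Kⁿ`: formal power series in `n` commuting variables. -/
abbrev FormalFunction (K : Type*) [Field K] (n : ℕ) : Type _ :=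
  MvPowerSeries (Fin n) K

/-- Formal vector fields on `Kⁿ`: `K`-linear derivations of the algebra of formal functions. -/
abbrev FormalVectorField (K : Type*) [Field K] (n : ℕ) : Type _ :=
  Derivation K (FormalFunction K n) (FormalFunction K n)

/-- Formal diffeomorphisms of `Kⁿ`: `K`-algebra automorphisms of the algebra of formal
functions. -/
abbrev FormalDiffeo (K : Type*) [Field K] (n : ℕ) : Type _ :=
  FormalFunction K n ≃ₐ[K] FormalFunction K n

/-- The pullback `φ^*X = φ ∘ X ∘ φ⁻¹` of a formal vector field along a formal diffeomorphism. -/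
noncomputable def pullback {K : Type*} [Field K] {n : ℕ} (φ : FormalDiffeo K n)
    (X : FormalVectorField K n) : FormalVectorField K n :=
  Derivation.mk' (φ.toLinearMap ∘ₗ X.toLinearMap ∘ₗ φ.symm.toLinearMap) (by
    intro f g
    simp)

theorem pullback_apply {K : Type*} [Field K] {n : ℕ} (φ : FormalDiffeo K n)
    (X : FormalVectorField K n) (f : FormalFunction K n) :
    pullback φ X f = φ (X (φ.symm f)) := rfl

/-- A weighting of `Kⁿ`: integers `1 ≤ w₁ ≤ w₂ ≤ ⋯ ≤ wₙ`, where `wᵢ` is the weight of the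
`i`-th coordinate. -/
structure Weighting (n : ℕ) where
  /-- The weight of each coordinate. -/
  weight : Fin n → ℕ
  one_le : ∀ i, 1 ≤ weight i
  monotone : Monotone weight

/-- The weighted degree `⟨w, α⟩ = ∑ᵢ wᵢ αᵢ` of the monomial `x^α`. -/
def weightedDegree {n : ℕ} (w : Weighting n) (α : Fin n →₀ ℕ) : ℕ :=
  ∑ i, w.weight i * α i

/-- The ideal `ℱ^k` of formal functions generated by the monomials `x^α` of weighted degree at
least `k`. (For `k ≤ 0` this is the whole algebra.) -/
noncomputable def functionFiltration (K : Type*) [Field K] {n : ℕ} (w : Weighting n) (k : ℤ) :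
    Ideal (FormalFunction K n) :=
  Ideal.span {f | ∃ α : Fin n →₀ ℕ, k ≤ (weightedDegree w α : ℤ) ∧
    f = MvPowerSeries.monomial α (1 : K)}

/-- The submodule of formal vector fields that raise the filtration degree of formal functions
by `k`. -/
noncomputable def vectorFieldFiltration (K : Type*) [Field K] {n : ℕ} (w : Weighting n) (k : ℤ) :
    Submodule (FormalFunction K n) (FormalVectorField K n) where
  carrier := {X | ∀ (j : ℤ), ∀ f ∈ functionFiltration K w j,
    X f ∈ functionFiltration K w (j + k)}
  add_mem' := by
    intro X Y hX hY j f hf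
    exact Ideal.add_mem _ (hX j f hf) (hY j f hf)
  zero_mem' := by
    intro j f _
    exact Ideal.zero_mem _
  smul_mem' := by
    intro g X hX j f hf
    exact Ideal.mul_mem_left _ g (hX j f hf)

/-- A formal vector field `X` is `w`-admissible if it does not lower filtration degree. -/
def IsAdmissible {K : Type*} [Field K] {n : ℕ} (w : Weighting n)
    (X : FormalVectorField K n) : Prop :=
  X ∈ vectorFieldFiltration K w 0

/-- The part of weighted degree `k` of a formal function: only the terms `c_α x^α` with
`⟨w, α⟩ = k` are kept. -/
noncomputable def functionPart {K : Type*} [Field K] {n : ℕ} (w : Weighting n) (k : ℤ)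
    (f : FormalFunction K n) : FormalFunction K n :=
  fun α => if (weightedDegree w α : ℤ) = k then MvPowerSeries.coeff α f else 0

/-- The part `X_[k]` of weighted degree `k` of a formal vector field `X = ∑ᵢ Xⁱ ∂/∂xⁱ`, where
`Xⁱ = X(xⁱ)`: only the terms `c_α x^α ∂/∂xⁱ` with `⟨w, α⟩ - wᵢ = k` are kept. -/
noncomputable def vectorFieldPart {K : Type*} [Field K] {n : ℕ} (w : Weighting n) (k : ℤ)
    (X : FormalVectorField K n) : FormalVectorField K n :=
  ∑ i, functionPart w ((w.weight i : ℤ) + k) (X (MvPowerSeries.X i)) • MvPowerSeries.pderiv K i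

/-- The weighted linear approximation `X_[0]` of `X`. -/
noncomputable def weightedLinearApprox {K : Type*} [Field K] {n : ℕ} (w : Weighting n)
    (X : FormalVectorField K n) : FormalVectorField K n :=
  vectorFieldPart w 0 X

/-- The weighted Euler vector field `∑ᵢ wᵢ xⁱ ∂/∂xⁱ`. -/
noncomputable def weightedEuler (K : Type*) [Field K] {n : ℕ} (w : Weighting n) :
    FormalVectorField K n :=
  ∑ i, ((w.weight i : FormalFunction K n) * MvPowerSeries.X i) • MvPowerSeries.pderiv K i

/-- A formal vector field is weighted Euler-like if it is `w`-admissible and its weighted linear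
approximation is the weighted Euler vector field. -/
def IsWeightedEulerLike {K : Type*} [Field K] {n : ℕ} (w : Weighting n)
    (X : FormalVectorField K n) : Prop :=
  IsAdmissible w X ∧ weightedLinearApprox w X = weightedEuler K w

end FormalWeighted

/-! To leading order `X` is the Euler field, so by the Leibniz rule it acts on the graded piece of
weighted degree `k` as multiplication by `k` (`derivation_sub_zsmul_mem`). In characteristic zero `X
- d` is therefore invertible in degrees above `d`, and each coordinate `x^i` can be corrected by
higher-order terms to a series `y_i` with `X y_i = w_i y_i` (`exists_eigenfunction`). The
substitution `ψ : x^i ↦ y_i` is the identity on the associated graded algebra, hence bijective by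
completeness (`algHom_bijective`). It intertwines the Euler field and `X` on coordinates, hence
everywhere (`related_of_related_X`), and `φ = ψ⁻¹` is the required diffeomorphism. -/

namespace FormalWeighted

open MvPowerSeries

variable {K : Type*} [Field K] {n : ℕ} {w : Weighting n}

/-! ### The weighted filtration: coefficients, products, completeness. -/

theorem weightedDegree_zero (w : Weighting n) : weightedDegree w 0 = 0 := by
  simp [weightedDegree]

theorem weightedDegree_add (w : Weighting n) (α β : Fin n →₀ ℕ) :
    weightedDegree w (α + β) = weightedDegree w α + weightedDegree w β := by
  simp [weightedDegree, mul_add, Finset.sum_add_distrib]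

theorem weightedDegree_single_one (w : Weighting n) (i : Fin n) :
    weightedDegree w (Finsupp.single i 1) = w.weight i := by
  simp [weightedDegree, Finsupp.single_apply]

theorem weightedDegree_mono (w : Weighting n) : Monotone (weightedDegree w) := fun _ _ h =>
  Finset.sum_le_sum fun i _ => Nat.mul_le_mul_left _ (h i)

theorem weightedDegree_pos (w : Weighting n) {α : Fin n →₀ ℕ} (hα : α ≠ 0) :
    0 < weightedDegree w α := by
  obtain ⟨i, hi⟩ := Finsupp.ne_iff.mp hα
  refine Finset.sum_pos' (fun _ _ => Nat.zero_le _) ⟨i, Finset.mem_univ _, ?_⟩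
  exact Nat.mul_pos (w.one_le i) (Nat.pos_of_ne_zero hi)

/-- By Dickson's lemma, a power series all of whose monomials have weighted degree at least `k`
is a finite combination of such monomials. -/
theorem mem_functionFiltration_of_coeff {k : ℤ} {f : FormalFunction K n}
    (hf : ∀ α, (weightedDegree w α : ℤ) < k → coeff α f = 0) :
    f ∈ functionFiltration K w k := by
  classical
  let M : Set (Fin n →₀ ℕ) := {α | Minimal (fun β => k ≤ (weightedDegree w β : ℤ)) α}
  have hM : M.Finite := WellQuasiOrderedLE.finite_of_isAntichain (setOfPred_minimal_antichain _)
  have hex : ∀ β : Fin n →₀ ℕ, ∃ α, k ≤ (weightedDegree w β : ℤ) → α ≤ β ∧ α ∈ M := by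
    intro β
    by_cases hβ : k ≤ (weightedDegree w β : ℤ)
    · obtain ⟨α, h1, h2⟩ := exists_minimal_le_of_wellFoundedLT
        (fun β => k ≤ (weightedDegree w β : ℤ)) β hβ
      exact ⟨α, fun _ => ⟨h1, h2⟩⟩
    · exact ⟨0, fun h => absurd h hβ⟩
  choose m hm using hex
  -- Each exponent `β` of degree at least `k` is charged to one chosen minimal exponent `m β ≤ β`,
  -- so no term of `f` is counted twice.
  let g : (Fin n →₀ ℕ) → FormalFunction K n := fun α β =>
    if m (β + α) = α then coeff (β + α) f else 0
  have hg : ∀ α β, coeff β (g α) = if m (β + α) = α then coeff (β + α) f else 0 :=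
    fun _ _ => rfl
  have key : f = ∑ α ∈ hM.toFinset, g α * monomial α (1 : K) := by
    ext β
    simp only [map_sum, coeff_mul_monomial, mul_one, hg]
    by_cases hβ : k ≤ (weightedDegree w β : ℤ)
    · obtain ⟨h1, h2⟩ := hm β hβ
      rw [Finset.sum_eq_single (m β)]
      · simp [h1, tsub_add_cancel_of_le h1]
      · intro α _ hα
        split_ifs with h3 h4
        · rw [tsub_add_cancel_of_le h3] at h4
          exact absurd h4.symm hα
        · rfl
        · rfl
      · intro h
        exact absurd (hM.mem_toFinset.mpr h2) h
    · have h0 := hf β (not_le.mp hβ)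
      rw [h0, Finset.sum_eq_zero]
      intro α _
      split_ifs with h3 h4
      · rw [tsub_add_cancel_of_le h3, h0]
      · rfl
      · rfl
  rw [key]
  refine Ideal.sum_mem _ fun α hα => Ideal.mul_mem_left _ _ ?_
  have hmin : Minimal (fun β => k ≤ (weightedDegree w β : ℤ)) α := hM.mem_toFinset.mp hα
  exact Ideal.subset_span ⟨α, hmin.prop, rfl⟩

/-- Membership is used in both forms: generators allow span induction, coefficients give products
and limits. -/
theorem mem_functionFiltration_iff {k : ℤ} {f : FormalFunction K n} :
    f ∈ functionFiltration K w k ↔ ∀ α, (weightedDegree w α : ℤ) < k → coeff α f = 0 := by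
  classical
  refine ⟨fun hf => ?_, mem_functionFiltration_of_coeff⟩
  refine Submodule.span_induction ?_ ?_ ?_ ?_ hf
  · rintro _ ⟨β, hβ, rfl⟩ α hα
    rw [coeff_monomial, if_neg]
    rintro rfl
    omega
  · intro α _
    exact map_zero _
  · intro f g _ _ h1 h2 α hα
    rw [map_add, h1 α hα, h2 α hα, add_zero]
  · intro a f _ h α hα
    rw [smul_eq_mul, coeff_mul]
    refine Finset.sum_eq_zero fun p hp => ?_
    rw [h p.2, mul_zero]
    have hle : p.2 ≤ α := by
      rw [← Finset.HasAntidiagonal.mem_antidiagonal.mp hp]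
      exact le_add_self
    have := weightedDegree_mono w hle
    omega

theorem functionFiltration_anti {j k : ℤ} (h : j ≤ k) :
    functionFiltration K w k ≤ functionFiltration K w j :=
  Ideal.span_mono fun _ ⟨α, hα, e⟩ => ⟨α, h.trans hα, e⟩

theorem mem_functionFiltration_of_nonpos {k : ℤ} (hk : k ≤ 0) (f : FormalFunction K n) :
    f ∈ functionFiltration K w k :=
  mem_functionFiltration_of_coeff fun α hα => by omega

theorem monomial_mem_functionFiltration (w : Weighting n) (α : Fin n →₀ ℕ) :
    monomial α (1 : K) ∈ functionFiltration K w (weightedDegree w α) :=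
  Ideal.subset_span ⟨α, le_rfl, rfl⟩

theorem X_mem_functionFiltration (w : Weighting n) (i : Fin n) :
    (X i : FormalFunction K n) ∈ functionFiltration K w (w.weight i) := by
  have := monomial_mem_functionFiltration (K := K) w (Finsupp.single i 1)
  rwa [weightedDegree_single_one] at this

theorem mul_mem_functionFiltration {j k : ℤ} {f g : FormalFunction K n}
    (hf : f ∈ functionFiltration K w j) (hg : g ∈ functionFiltration K w k) :
    f * g ∈ functionFiltration K w (j + k) := by
  classical
  rw [mem_functionFiltration_iff] at *
  intro α hα
  rw [coeff_mul]
  refine Finset.sum_eq_zero fun p hp => ?_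
  rw [← Finset.HasAntidiagonal.mem_antidiagonal.mp hp, weightedDegree_add] at hα
  by_cases h : (weightedDegree w p.1 : ℤ) < j
  · rw [hf _ h, zero_mul]
  · rw [hg p.2 (by push_cast at hα; omega), mul_zero]

theorem smul_mem_functionFiltration {k : ℤ} (c : K) {f : FormalFunction K n}
    (hf : f ∈ functionFiltration K w k) : c • f ∈ functionFiltration K w k := by
  rw [smul_eq_C_mul]
  exact Ideal.mul_mem_left _ _ hf

theorem eq_zero_of_forall_mem_functionFiltration {f : FormalFunction K n}
    (hf : ∀ k : ℕ, f ∈ functionFiltration K w k) : f = 0 := by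
  ext α
  exact mem_functionFiltration_iff.mp (hf (weightedDegree w α + 1)) α (by push_cast; omega)

theorem sub_C_mem_functionFiltration_one (w : Weighting n) (f : FormalFunction K n) :
    f - C (constantCoeff f) ∈ functionFiltration K w 1 := by
  refine mem_functionFiltration_of_coeff fun α hα => ?_
  have : α = 0 := by
    by_contra h
    have := weightedDegree_pos w h
    omega
  subst this
  simp

theorem constantCoeff_eq_zero_of_mem {k : ℤ} (hk : 0 < k) {f : FormalFunction K n}
    (hf : f ∈ functionFiltration K w k) : constantCoeff f = 0 := by
  rw [← coeff_zero_eq_constantCoeff_apply]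
  exact mem_functionFiltration_iff.mp hf 0 (by simpa [weightedDegree_zero] using hk)

/-- The algebra of formal functions is complete for the weighted filtration. -/
theorem exists_limit (c : ℕ) (u : ℕ → FormalFunction K n)
    (hu : ∀ k : ℕ, u (k + 1) - u k ∈ functionFiltration K w (c + k)) :
    ∃ y : FormalFunction K n, ∀ k : ℕ, y - u k ∈ functionFiltration K w (c + k) := by
  have hstep : ∀ k l : ℕ, u (k + l) - u k ∈ functionFiltration K w (c + k) := by
    intro k l
    induction l with
    | zero => simp
    | succ l ih =>
      have h := functionFiltration_anti (by push_cast; omega) (hu (k + l)) (j := (c + k : ℤ))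
      simpa [add_assoc] using Ideal.add_mem _ h ih
  have hle : ∀ k l : ℕ, k ≤ l → ∀ α, (weightedDegree w α : ℤ) < c + k →
      coeff α (u l) = coeff α (u k) := by
    intro k l hkl α hα
    obtain ⟨l, rfl⟩ := Nat.exists_eq_add_of_le hkl
    have := mem_functionFiltration_iff.mp (hstep k l) α hα
    rwa [map_sub, sub_eq_zero] at this
  -- The coefficient at `α` is constant from index `weightedDegree w α + 1` on, even when `c = 0`.
  let y : FormalFunction K n := fun α => coeff α (u (weightedDegree w α + 1))
  have hy : ∀ α, coeff α y = coeff α (u (weightedDegree w α + 1)) := fun _ => rfl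
  refine ⟨y, fun k => mem_functionFiltration_of_coeff fun α hα => ?_⟩
  rw [map_sub, hy, sub_eq_zero]
  rcases le_total k (weightedDegree w α + 1) with h | h
  · exact hle _ _ h α hα
  · exact (hle _ _ h α (by push_cast; omega)).symm

/-! ### Derivations that are Euler to leading order. -/

section Derivation

variable {D : FormalVectorField K n}

theorem derivation_monomial_sub_mem
    (hD : ∀ i, D (X i) - (w.weight i : ℤ) • (X i : FormalFunction K n) ∈
      functionFiltration K w (w.weight i + 1)) (α : Fin n →₀ ℕ) :
    D (monomial α (1 : K)) - (weightedDegree w α : ℤ) • monomial α (1 : K) ∈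
      functionFiltration K w (weightedDegree w α + 1) := by
  have hadd : ∀ α β : Fin n →₀ ℕ,
      D (monomial α (1 : K)) - (weightedDegree w α : ℤ) • monomial α (1 : K) ∈
        functionFiltration K w (weightedDegree w α + 1) →
      D (monomial β (1 : K)) - (weightedDegree w β : ℤ) • monomial β (1 : K) ∈
        functionFiltration K w (weightedDegree w β + 1) →
      D (monomial (α + β) (1 : K)) - (weightedDegree w (α + β) : ℤ) • monomial (α + β) (1 : K) ∈
        functionFiltration K w (weightedDegree w (α + β) + 1) := by
    intro α β hα hβ
    have h1 := mul_mem_functionFiltration (monomial_mem_functionFiltration (K := K) w α) hβ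
    have h2 := mul_mem_functionFiltration (monomial_mem_functionFiltration (K := K) w β) hα
    have e : (monomial (α + β) (1 : K) : FormalFunction K n) =
        monomial α (1 : K) * monomial β (1 : K) := by rw [monomial_mul_monomial, mul_one]
    rw [e, D.leibniz, weightedDegree_add]
    convert Ideal.add_mem _ (functionFiltration_anti (le_of_eq ?_) h1)
      (functionFiltration_anti (le_of_eq ?_) h2) using 1
    · simp only [smul_eq_mul, zsmul_eq_mul]
      push_cast
      ring
    · push_cast
      ring
    · push_cast
      ring
  induction α using Finsupp.induction_linear with
  | zero =>
    have : (monomial 0 (1 : K) : FormalFunction K n) = 1 := rfl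
    simp [weightedDegree_zero, this]
  | add α β hα hβ => exact hadd α β hα hβ
  | single i m =>
    induction m with
    | zero =>
      have : (monomial 0 (1 : K) : FormalFunction K n) = 1 := rfl
      simp [weightedDegree_zero, this]
    | succ m ih =>
      rw [Finsupp.single_add]
      refine hadd _ _ ih ?_
      rw [weightedDegree_single_one]
      exact hD i

/-- Constants are killed and `ℱ^1` is preserved. This controls the term `f * D a` when `D` is
applied to a multiple `a * f`. -/
theorem derivation_mem_one
    (hD : ∀ i, D (X i) - (w.weight i : ℤ) • (X i : FormalFunction K n) ∈
      functionFiltration K w (w.weight i + 1)) (f : FormalFunction K n) :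
    D f ∈ functionFiltration K w 1 := by
  have key : ∀ g ∈ functionFiltration K w 1, D g ∈ functionFiltration K w 1 := by
    intro g hg
    refine Submodule.span_induction ?_ ?_ ?_ ?_ hg
    · rintro _ ⟨α, hα, rfl⟩
      have h1 := functionFiltration_anti (j := 1) (by omega) (derivation_monomial_sub_mem hD α)
      have h2 := functionFiltration_anti hα (monomial_mem_functionFiltration (K := K) w α)
      simpa using Ideal.add_mem _ h1 (zsmul_mem h2 (weightedDegree w α : ℤ))
    · simp
    · intro f g _ _ h1 h2
      rw [map_add]
      exact Ideal.add_mem _ h1 h2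
    · intro a f hf h
      rw [smul_eq_mul, D.leibniz]
      exact Ideal.add_mem _ (Ideal.mul_mem_left _ _ h) (Ideal.mul_mem_right _ _ hf)
  have h := key _ (sub_C_mem_functionFiltration_one w f)
  have hC : D (C (constantCoeff f)) = 0 := D.map_algebraMap (constantCoeff f)
  rwa [map_sub, hC, sub_zero] at h

/-- On the associated graded algebra, a derivation which is the weighted Euler vector field to
leading order acts on degree `k` as multiplication by `k`. -/
theorem derivation_sub_zsmul_mem
    (hD : ∀ i, D (X i) - (w.weight i : ℤ) • (X i : FormalFunction K n) ∈
      functionFiltration K w (w.weight i + 1)) {k : ℤ} {f : FormalFunction K n}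
    (hf : f ∈ functionFiltration K w k) :
    D f - k • f ∈ functionFiltration K w (k + 1) := by
  refine Submodule.span_induction ?_ ?_ ?_ ?_ hf
  · rintro _ ⟨α, hα, rfl⟩
    have h1 := derivation_monomial_sub_mem hD α
    rcases hα.eq_or_lt with h | h
    · rwa [h]
    · have h2 := functionFiltration_anti (j := k + 1) (by omega) h1
      have h3 := functionFiltration_anti (j := k + 1) (by omega)
        (monomial_mem_functionFiltration (K := K) w α)
      convert Ideal.add_mem _ h2 (zsmul_mem h3 ((weightedDegree w α : ℤ) - k)) using 1
      rw [sub_smul]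
      abel
  · simp
  · intro f g _ _ h1 h2
    convert Ideal.add_mem _ h1 h2 using 1
    rw [map_add, smul_add]
    abel
  · intro a f hf h
    convert Ideal.add_mem _ (Ideal.mul_mem_left _ a h)
      (mul_mem_functionFiltration hf (derivation_mem_one hD a)) using 1
    simp only [smul_eq_mul, D.leibniz, zsmul_eq_mul]
    ring

/-- Successive approximation: a residual `r` in degree `d + 1 + k` is removed to leading order by
subtracting `r / (k + 1)`, since `D - d` acts there as `k + 1`. -/
theorem exists_eigenfunction [CharZero K]
    (hD : ∀ i, D (X i) - (w.weight i : ℤ) • (X i : FormalFunction K n) ∈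
      functionFiltration K w (w.weight i + 1)) {d : ℕ} {f : FormalFunction K n}
    (hf : D f - (d : ℤ) • f ∈ functionFiltration K w (d + 1)) :
    ∃ y, D y = (d : ℤ) • y ∧ y - f ∈ functionFiltration K w (d + 1) := by
  let u : ℕ → FormalFunction K n := fun k =>
    k.rec f fun k g => g - ((k + 1 : K)⁻¹) • (D g - (d : ℤ) • g)
  have hu : ∀ k, u (k + 1) = u k - ((k + 1 : K)⁻¹) • (D (u k) - (d : ℤ) • u k) := fun _ => rfl
  have hr : ∀ k : ℕ, D (u k) - (d : ℤ) • u k ∈ functionFiltration K w ((d + 1 : ℕ) + k) := by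
    intro k
    induction k with
    | zero =>
      change D f - (d : ℤ) • f ∈ _
      simpa using hf
    | succ k ih =>
      have hk : (k + 1 : K) ≠ 0 := Nat.cast_add_one_ne_zero k
      -- The new residual equals `-(k + 1)⁻¹ • (D r - (d + 1 + k) • r)`, which lies one degree
      -- higher.
      have h := smul_mem_functionFiltration (-(k + 1 : K)⁻¹) (derivation_sub_zsmul_mem hD ih)
      have hdeg : ((d + 1 : ℕ) : ℤ) + k + 1 = (d + 1 : ℕ) + (k + 1 : ℕ) := by
        push_cast
        ring
      rw [hdeg] at h
      convert h using 1
      · rw [hu]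
        generalize hR : D (u k) - (d : ℤ) • u k = r
        have e : r = (k + 1 : K)⁻¹ • ((k : ℤ) + 1) • r := by
          rw [← Int.cast_smul_eq_zsmul K, smul_smul]
          push_cast
          rw [inv_mul_cancel₀ hk, one_smul]
        rw [map_sub, D.map_smul, smul_sub, smul_comm (d : ℤ) ((k + 1 : K)⁻¹) r]
        have e2 : (((d + 1 : ℕ) : ℤ) + (k : ℤ)) • r = (d : ℤ) • r + ((k : ℤ) + 1) • r := by
          rw [← add_smul]
          congr 1
          push_cast
          ring
        rw [e2, neg_smul, smul_sub, smul_add, ← e]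
        rw [← hR]
        abel
  obtain ⟨y, hy⟩ := exists_limit (w := w) (d + 1) u fun k => by
    rw [hu, sub_sub_cancel_left]
    exact Ideal.neg_mem_iff _ |>.mpr (smul_mem_functionFiltration _ (hr k))
  refine ⟨y, ?_, by simpa [u] using hy 0⟩
  rw [← sub_eq_zero]
  refine eq_zero_of_forall_mem_functionFiltration (w := w) fun k => ?_
  have h1 := functionFiltration_anti (j := (k : ℤ)) (by push_cast; omega)
    (derivation_sub_zsmul_mem hD (hy k))
  have h2 := functionFiltration_anti (j := (k : ℤ)) (by push_cast; omega) (hy k)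
  have h3 := functionFiltration_anti (j := (k : ℤ)) (by push_cast; omega) (hr k)
  -- With `z = y - u k`: `D y - d y = (D z - (d + 1 + k) z) + (k + 1) z + (D (u k) - d (u k))`.
  convert Ideal.add_mem _ (Ideal.add_mem _ h1 (zsmul_mem h2 ((k : ℤ) + 1))) h3 using 1
  push_cast
  simp only [map_sub, zsmul_eq_mul]
  push_cast
  ring

end Derivation

/-! ### Endomorphisms that are the identity to leading order. -/

section AlgHom

variable {ψ : FormalFunction K n →ₐ[K] FormalFunction K n}

theorem algHom_monomial_sub_mem
    (hψ : ∀ i, ψ (X i) - X i ∈ functionFiltration K w (w.weight i + 1)) (α : Fin n →₀ ℕ) :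
    ψ (monomial α (1 : K)) - monomial α (1 : K) ∈
      functionFiltration K w (weightedDegree w α + 1) := by
  have hadd : ∀ α β : Fin n →₀ ℕ,
      ψ (monomial α (1 : K)) - monomial α (1 : K) ∈
        functionFiltration K w (weightedDegree w α + 1) →
      ψ (monomial β (1 : K)) - monomial β (1 : K) ∈
        functionFiltration K w (weightedDegree w β + 1) →
      ψ (monomial (α + β) (1 : K)) - monomial (α + β) (1 : K) ∈
        functionFiltration K w (weightedDegree w (α + β) + 1) := by
    intro α β hα hβ
    have h0 := Ideal.add_mem _ (functionFiltration_anti (by omega) hα)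
      (monomial_mem_functionFiltration (K := K) w α)
    rw [sub_add_cancel] at h0
    have h1 := mul_mem_functionFiltration h0 hβ
    have h2 := mul_mem_functionFiltration (monomial_mem_functionFiltration (K := K) w β) hα
    have e : (monomial (α + β) (1 : K) : FormalFunction K n) =
        monomial α (1 : K) * monomial β (1 : K) := by rw [monomial_mul_monomial, mul_one]
    rw [e, map_mul, weightedDegree_add]
    convert Ideal.add_mem _ (functionFiltration_anti (le_of_eq ?_) h1)
      (functionFiltration_anti (le_of_eq ?_) h2) using 1
    · ring
    · push_cast
      ring
    · push_cast
      ring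
  induction α using Finsupp.induction_linear with
  | zero =>
    have : (monomial 0 (1 : K) : FormalFunction K n) = 1 := rfl
    simp [this]
  | add α β hα hβ => exact hadd α β hα hβ
  | single i m =>
    induction m with
    | zero =>
      have : (monomial 0 (1 : K) : FormalFunction K n) = 1 := rfl
      simp [this]
    | succ m ih =>
      rw [Finsupp.single_add]
      refine hadd _ _ ih ?_
      rw [weightedDegree_single_one]
      exact hψ i

theorem algHom_sub_mem_one
    (hψ : ∀ i, ψ (X i) - X i ∈ functionFiltration K w (w.weight i + 1))
    (f : FormalFunction K n) : ψ f - f ∈ functionFiltration K w 1 := by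
  have key : ∀ g ∈ functionFiltration K w 1, ψ g - g ∈ functionFiltration K w 1 := by
    intro g hg
    refine Submodule.span_induction ?_ ?_ ?_ ?_ hg
    · rintro _ ⟨α, hα, rfl⟩
      exact functionFiltration_anti (by omega) (algHom_monomial_sub_mem hψ α)
    · simp
    · intro f g _ _ h1 h2
      rw [map_add, add_sub_add_comm]
      exact Ideal.add_mem _ h1 h2
    · intro a f hf h
      convert Ideal.add_mem _ (Ideal.mul_mem_left _ (ψ a) h)
        (Ideal.mul_mem_left _ (ψ a - a) hf) using 1
      rw [smul_eq_mul, map_mul]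
      ring
  have h := key _ (sub_C_mem_functionFiltration_one w f)
  have hC : ψ (C (constantCoeff f)) = C (constantCoeff f) := ψ.commutes (constantCoeff f)
  rwa [map_sub, hC, sub_sub_sub_cancel_right] at h

/-- An algebra endomorphism which is the identity to leading order on coordinates induces the
identity on the associated graded algebra. -/
theorem algHom_sub_mem
    (hψ : ∀ i, ψ (X i) - X i ∈ functionFiltration K w (w.weight i + 1)) {k : ℤ}
    {f : FormalFunction K n} (hf : f ∈ functionFiltration K w k) :
    ψ f - f ∈ functionFiltration K w (k + 1) := by
  refine Submodule.span_induction ?_ ?_ ?_ ?_ hf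
  · rintro _ ⟨α, hα, rfl⟩
    exact functionFiltration_anti (by omega) (algHom_monomial_sub_mem hψ α)
  · simp
  · intro f g _ _ h1 h2
    rw [map_add, add_sub_add_comm]
    exact Ideal.add_mem _ h1 h2
  · intro a f hf h
    convert Ideal.add_mem _ (Ideal.mul_mem_left _ (ψ a) h)
      (mul_mem_functionFiltration hf (algHom_sub_mem_one hψ a)) using 1
    rw [smul_eq_mul, map_mul]
    ring

/-- Since `ψ - 1` raises degree, a kernel element lies in every `ℱ^k`, and the iteration `u ↦ u + (g
- ψ u)` converges to a preimage of `g`. -/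
theorem algHom_bijective
    (hψ : ∀ i, ψ (X i) - X i ∈ functionFiltration K w (w.weight i + 1)) :
    Function.Bijective ψ := by
  constructor
  · rw [injective_iff_map_eq_zero]
    intro f hf
    refine eq_zero_of_forall_mem_functionFiltration (w := w) fun k => ?_
    induction k with
    | zero => exact mem_functionFiltration_of_nonpos le_rfl f
    | succ k ih =>
      have h := algHom_sub_mem hψ ih
      rw [hf, zero_sub] at h
      exact_mod_cast (Ideal.neg_mem_iff _).mp h
  · intro g
    let u : ℕ → FormalFunction K n := fun k => k.rec 0 fun _ f => f + (g - ψ f)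
    have hu : ∀ k, u (k + 1) = u k + (g - ψ (u k)) := fun _ => rfl
    have hr : ∀ k : ℕ, g - ψ (u k) ∈ functionFiltration K w k := by
      intro k
      induction k with
      | zero => exact mem_functionFiltration_of_nonpos le_rfl _
      | succ k ih =>
        have h := (Ideal.neg_mem_iff _).mpr (algHom_sub_mem hψ ih)
        rw [hu, map_add]
        push_cast
        convert h using 1
        ring
    obtain ⟨y, hy⟩ := exists_limit (w := w) 0 u fun k => by
      rw [hu, add_sub_cancel_left]
      simpa using hr k
    refine ⟨y, sub_eq_zero.mp (eq_zero_of_forall_mem_functionFiltration (w := w) fun k => ?_)⟩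
    have h0 : y - u k ∈ functionFiltration K w k := by simpa using hy k
    have h1 := functionFiltration_anti (j := (k : ℤ)) (by omega) (algHom_sub_mem hψ h0)
    convert Ideal.sub_mem _ (Ideal.add_mem _ h1 h0) (hr k) using 1
    rw [map_sub]
    ring

/-- Two vector fields which are `ψ`-related on coordinates are `ψ`-related. -/
theorem related_of_related_X
    (hψ : ∀ i, ψ (X i) - X i ∈ functionFiltration K w (w.weight i + 1))
    {D E : FormalVectorField K n} (h : ∀ i, ψ (E (X i)) = D (ψ (X i)))
    (f : FormalFunction K n) : ψ (E f) = D (ψ f) := by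
  -- The defect `ψ ∘ E - D ∘ ψ` is a derivation along `ψ`. Vanishing on monomials does not settle
  -- infinite series, as no continuity is assumed.
  have hmul : ∀ a b : FormalFunction K n, ψ (E (a * b)) - D (ψ (a * b)) =
      ψ a * (ψ (E b) - D (ψ b)) + ψ b * (ψ (E a) - D (ψ a)) := by
    intro a b
    simp only [map_mul, Derivation.leibniz, smul_eq_mul, map_add]
    ring
  have hmon : ∀ α : Fin n →₀ ℕ, ψ (E (monomial α (1 : K))) - D (ψ (monomial α (1 : K))) = 0 := by
    intro α
    induction α using Finsupp.induction_linear with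
    | zero =>
      have : (monomial 0 (1 : K) : FormalFunction K n) = 1 := rfl
      simp [this]
    | add α β hα hβ =>
      have e : (monomial (α + β) (1 : K) : FormalFunction K n) =
        monomial α (1 : K) * monomial β (1 : K) := by rw [monomial_mul_monomial, mul_one]
      rw [e, hmul, hα, hβ]
      simp
    | single i m =>
      rw [← X_pow_eq]
      induction m with
      | zero => simp
      | succ m ih => rw [pow_succ, hmul, ih, h i]; simp
  -- If all defects lie in `ℱ^k`, the defect of `a * f` with `f` in `ℱ^1` gains a degree from the
  -- factor `ψ f`; hence the quantifier over all `g` inside the induction.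
  have key : ∀ (k : ℕ) (g : FormalFunction K n),
      ψ (E g) - D (ψ g) ∈ functionFiltration K w k := by
    intro k
    induction k with
    | zero => exact fun g => mem_functionFiltration_of_nonpos le_rfl _
    | succ k ih =>
      intro g
      have hpos : ∀ g ∈ functionFiltration K w 1,
          ψ (E g) - D (ψ g) ∈ functionFiltration K w ((k + 1 : ℕ) : ℤ) := by
        intro g hg
        refine (Submodule.span_induction (p := fun g _ => ψ g ∈ functionFiltration K w 1 ∧
          ψ (E g) - D (ψ g) ∈ functionFiltration K w ((k + 1 : ℕ) : ℤ)) ?_ ?_ ?_ ?_ hg).2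
        · rintro _ ⟨α, hα, rfl⟩
          rw [hmon]
          have := functionFiltration_anti hα (monomial_mem_functionFiltration (K := K) w α)
          refine ⟨?_, Ideal.zero_mem _⟩
          simpa using Ideal.add_mem _ (algHom_sub_mem_one hψ (monomial α (1 : K))) this
        · simp
        · intro f g _ _ h1 h2
          simp only [map_add, add_sub_add_comm]
          exact ⟨Ideal.add_mem _ h1.1 h2.1, Ideal.add_mem _ h1.2 h2.2⟩
        · intro a f _ h
          rw [smul_eq_mul, hmul]
          refine ⟨by rw [map_mul]; exact Ideal.mul_mem_left _ _ h.1,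
            Ideal.add_mem _ (Ideal.mul_mem_left _ _ h.2) ?_⟩
          have := mul_mem_functionFiltration h.1 (ih a)
          rwa [add_comm] at this
      have h := hpos _ (sub_C_mem_functionFiltration_one w g)
      have hE : E (C (constantCoeff g)) = 0 := E.map_algebraMap (constantCoeff g)
      have hC : ψ (C (constantCoeff g)) = C (constantCoeff g) := ψ.commutes (constantCoeff g)
      have hD : D (C (constantCoeff g)) = 0 := D.map_algebraMap (constantCoeff g)
      rwa [map_sub, map_sub, map_sub, map_sub, hE, hC, hD, map_zero, sub_zero, sub_zero] at h
  exact sub_eq_zero.mp (eq_zero_of_forall_mem_functionFiltration fun k => key k f)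

end AlgHom

/-! ### Euler-like fields on coordinates. -/

theorem derivation_sum_apply {ι : Type*} (s : Finset ι) (D : ι → FormalVectorField K n)
    (f : FormalFunction K n) : (∑ i ∈ s, D i) f = ∑ i ∈ s, D i f := by
  classical
  induction s using Finset.induction_on with
  | empty => simp
  | insert i s hi ih => rw [Finset.sum_insert hi, Finset.sum_insert hi, Derivation.add_apply, ih]

theorem weightedEuler_X (w : Weighting n) (i : Fin n) :
    weightedEuler K w (X i) = (w.weight i : ℤ) • (X i : FormalFunction K n) := by
  classical
  rw [weightedEuler, derivation_sum_apply, Finset.sum_eq_single i]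
  · simp
  · intro j _ hj
    simp [pderiv_X_of_ne hj.symm]
  · simp

theorem weightedLinearApprox_X (w : Weighting n) (D : FormalVectorField K n) (i : Fin n) :
    weightedLinearApprox w D (X i) = functionPart w (w.weight i) (D (X i)) := by
  classical
  rw [weightedLinearApprox, vectorFieldPart, derivation_sum_apply,
    Finset.sum_eq_single i]
  · simp
  · intro j _ hj
    simp [pderiv_X_of_ne hj.symm]
  · simp

theorem coeff_functionPart (w : Weighting n) (k : ℤ) (f : FormalFunction K n)
    (α : Fin n →₀ ℕ) :
    coeff α (functionPart w k f) = if (weightedDegree w α : ℤ) = k then coeff α f else 0 := rfl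

/-- Admissibility removes the terms of degree below `w_i`; the linear approximation fixes those of
degree exactly `w_i`. -/
theorem IsWeightedEulerLike.apply_X_sub_mem {D : FormalVectorField K n}
    (hD : IsWeightedEulerLike w D) (i : Fin n) :
    D (X i) - (w.weight i : ℤ) • (X i : FormalFunction K n) ∈
      functionFiltration K w (w.weight i + 1) := by
  have h1 : D (X i) ∈ functionFiltration K w (w.weight i) := by
    simpa using hD.1 _ _ (X_mem_functionFiltration w i)
  have h2 := Ideal.sub_mem _ h1 (zsmul_mem (X_mem_functionFiltration w i) (w.weight i : ℤ))
  have h3 : functionPart w (w.weight i) (D (X i)) =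
      (w.weight i : ℤ) • (X i : FormalFunction K n) := by
    rw [← weightedLinearApprox_X, hD.2, weightedEuler_X]
  refine mem_functionFiltration_of_coeff fun α hα => ?_
  rcases (Int.lt_add_one_iff.mp hα).lt_or_eq with h | h
  · exact mem_functionFiltration_iff.mp h2 α h
  · rw [map_sub, ← h3, coeff_functionPart, if_pos h, sub_self]

end FormalWeighted

/-! ### The linearizing diffeomorphism. -/

open FormalWeighted in
theorem proposition4p1 {K : Type*} [Field K] [CharZero K] {n : ℕ}
    (w : FormalWeighted.Weighting n) (X : FormalWeighted.FormalVectorField K n)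
    (hX : FormalWeighted.IsWeightedEulerLike w X) :
    ∃ φ : FormalWeighted.FormalDiffeo K n,
      FormalWeighted.pullback φ X = FormalWeighted.weightedEuler K w := by
  have hD := hX.apply_X_sub_mem
  choose y hy hyX using fun i => exists_eigenfunction hD (hD i)
  -- Weights are at least `1`, so each `y i` has no constant term.
  have hsub : MvPowerSeries.HasSubst y := by
    refine MvPowerSeries.hasSubst_of_constantCoeff_zero fun i => ?_
    have := Ideal.add_mem _ (functionFiltration_anti (by omega) (hyX i))
      (X_mem_functionFiltration w i)
    rw [sub_add_cancel] at this
    exact constantCoeff_eq_zero_of_mem (by exact_mod_cast w.one_le i) this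
  let ψ : FormalFunction K n →ₐ[K] FormalFunction K n := MvPowerSeries.substAlgHom hsub
  have hψX : ∀ i, ψ (MvPowerSeries.X i) = y i := MvPowerSeries.substAlgHom_X hsub
  have hψ : ∀ i, ψ (MvPowerSeries.X i) - MvPowerSeries.X i ∈
      functionFiltration K w (w.weight i + 1) := fun i => by
    rw [hψX]
    exact hyX i
  have hrel := related_of_related_X hψ (D := X) (E := weightedEuler K w) fun i => by
    rw [hψX, hy, weightedEuler_X, map_zsmul, hψX]
  let Ψ : FormalDiffeo K n := AlgEquiv.ofBijective ψ (algHom_bijective hψ)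
  -- `Ψ ∘ E = X ∘ Ψ` reads `Ψ⁻¹ ∘ X ∘ Ψ = E`, so the inverse is the witness.
  refine ⟨Ψ.symm, Derivation.ext fun f => ?_⟩
  rw [pullback_apply, AlgEquiv.symm_symm, AlgEquiv.symm_apply_eq]
  exact (hrel f).symm
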